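/- Let $n\ge 1$, let $X_1,\dots,X_n$ be independent, identically distributed real-valued random variables (in particular, they may be positive-integer-valued), with arbitrary common distribution, and let $X_{1,n}\ge X_{2,n}\ge\dots\ge X_{n,n}$ be their order statistics in non-increasing order. Define the empirical threshold $$M_n=\min\bigl(n,\ \inf\{k\in\{1,\dots,n\}: X_{k,n}\le k\}\bigr),\qquad \inf\varnothing=+\infty .$$ Call a non-negative random variable $Z=g(X_1,\dots,X_n)$ *self-bounded* if there are measurable functions $g_1,\dots,g_n$ such that, with $Z_i=g_i(X_1,\dots,X_{i-1},X_{i+1},\dots,X_n)$, one has $0\le Z-Z_i\le 1$ for every $i\le n$ and $\sum_{i=1}^n (Z-Z_i)\le Z$. Then: (i) $M_n$ is self-bounded. (ii) $M_n$ is square-integrable and $\operatorname{Var}(M_n)\le \mathbb{E}M_n$; moreover, for every $\lambda\in\mathbb{R}$, $\mathrm{e}^{\lambda(M_n-\mathbb{E}M_n)}$ is integrable and, with $\log$ the natural logarithm, $$\log \mathbb{E}\bigl[\mathrm{e}^{\lambda(M_n-\mathbb{E}M_n)}\bigr]\le \mathbb{E}M_n\,\bigl(\mathrm{e}^{\lambda}-\lambda-1\bigr).$$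 (iii) For every $t>0$, $$\mathbb{P}\{M_n-\mathbb{E}M_n\ge t\}\le \exp\Bigl(-\frac{t^2}{2(\mathbb{E}M_n+t/3)}\Bigr)\qquad\text{and}\qquad \mathbb{P}\{M_n-\mathbb{E}M_n\le -t\}\le \exp\Bigl(-\frac{t^2}{2\,\mathbb{E}M_n}\Bigr).$$ -/

import Mathlib

open MeasureTheory ProbabilityTheory

/-- The order statistics of a sample `x` of size `n` in non-increasing order.
`orderStat x j` is the `(j + 1)`-th largest value `X_{j+1,n}`, counted with multiplicity
(`j` runs through `0, …, n - 1`).  `Tuple.sort x` is a permutation of the indices that puts `x`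
in non-decreasing order and `Fin.rev` reverses that order. -/
noncomputable def orderStat {n : ℕ} (x : Fin n → ℝ) (j : Fin n) : ℝ :=
  x (Tuple.sort x j.rev)

/-- The empirical threshold `min (n, inf {k : X_{k,n} ≤ k})` of a sample `x` of size `n`, where
the rank `k` ranges over `1, …, n`.  It is the least element of a set that contains `n`. -/
noncomputable def empThreshold {n : ℕ} (x : Fin n → ℝ) : ℕ :=
  sInf (insert n {k : ℕ | ∃ j : Fin n, k = (j : ℕ) + 1 ∧ orderStat x j ≤ (k : ℝ)})

/-- `Z` is a self-bounded random variable, as a function of `X 0, …, X (n - 1)`: it is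
non-negative, it is a measurable function of the `X i`, and there are measurable functions `h i`
of the variables other than `X i` such that `Z i := h i (X j, j ≠ i)` satisfies
`0 ≤ Z - Z i ≤ 1` for every `i` and `∑ i, (Z - Z i) ≤ Z`. -/
structure IsSelfBounded {Ω E : Type*} [MeasurableSpace E] {n : ℕ}
    (X : Fin n → Ω → E) (Z : Ω → ℝ) : Prop where
  nonneg : ∀ ω, 0 ≤ Z ω
  exists_eq : ∃ g : (Fin n → E) → ℝ, Measurable g ∧ ∀ ω, Z ω = g (fun i => X i ω)
  exists_bound : ∃ h : (i : Fin n) → ({j : Fin n // j ≠ i} → E) → ℝ,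
    (∀ i, Measurable (h i)) ∧
    (∀ ω i, 0 ≤ Z ω - h i (fun j => X j ω) ∧ Z ω - h i (fun j => X j ω) ≤ 1) ∧
    ∀ ω, ∑ i, (Z ω - h i (fun j => X j ω)) ≤ Z ω

/-! The threshold M depends on the sample only through the counts N(k) = #{i : X_i > k}: for 1 ≤ k <
n, M ≤ k exactly when N(k) < k. Replacing X_i by 0 removes it from every count, so M drops by 0 or
1. A drop forces X_i > M - 1 and N(M - 1) ≤ M - 1, so the total drop is at most M
(`sum_empThreshold_sub_update_le`). This is self-boundedness.

Concentration follows by the entropy method. Write ψ for the log-Laplace transform of M.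
Sub-additivity of entropy (`entropy_pi_le_sum`) and convexity of exp give (1 - e^{-λ}) ψ'(λ) ≤ ψ(λ).
Hence ψ(λ)/(e^λ - 1) is non-increasing on each side of 0, where it tends to E M, and ψ(λ) ≤ E M (e^λ
- 1) for all real λ (`cgf_le_of_entropy_le`). The variance bound is the second-order comparison at λ
= 0; the tails are Chernoff bounds. -/

/-- A real function that is measurable and bounded. -/
def IsBddMeasurable {α : Type*} [MeasurableSpace α] (f : α → ℝ) : Prop :=
  Measurable f ∧ ∃ C : ℝ, ∀ x, |f x| ≤ C

namespace IsBddMeasurable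

variable {α β : Type*} [MeasurableSpace α] [MeasurableSpace β] {f g : α → ℝ}

theorem const (c : ℝ) : IsBddMeasurable (fun _ : α => c) :=
  ⟨measurable_const, |c|, fun _ => le_rfl⟩

theorem add (hf : IsBddMeasurable f) (hg : IsBddMeasurable g) :
    IsBddMeasurable (fun x => f x + g x) := by
  obtain ⟨hf, C, hC⟩ := hf
  obtain ⟨hg, D, hD⟩ := hg
  exact ⟨hf.add hg, C + D, fun x => (abs_add_le _ _).trans (add_le_add (hC x) (hD x))⟩

theorem mul (hf : IsBddMeasurable f) (hg : IsBddMeasurable g) :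
    IsBddMeasurable (fun x => f x * g x) := by
  obtain ⟨hf, C, hC⟩ := hf
  obtain ⟨hg, D, hD⟩ := hg
  refine ⟨hf.mul hg, C * D, fun x => ?_⟩
  rw [abs_mul]
  exact mul_le_mul (hC x) (hD x) (abs_nonneg _) ((abs_nonneg _).trans (hC x))

theorem const_mul (c : ℝ) (hf : IsBddMeasurable f) : IsBddMeasurable (fun x => c * f x) :=
  (const c).mul hf

theorem sub (hf : IsBddMeasurable f) (hg : IsBddMeasurable g) :
    IsBddMeasurable (fun x => f x - g x) := by
  simpa [sub_eq_add_neg] using hf.add (hg.const_mul (-1))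

theorem exp (hf : IsBddMeasurable f) : IsBddMeasurable (fun x => Real.exp (f x)) := by
  obtain ⟨hf, C, hC⟩ := hf
  refine ⟨hf.exp, Real.exp C, fun x => ?_⟩
  rw [abs_of_pos (Real.exp_pos _)]
  exact Real.exp_le_exp.2 ((le_abs_self _).trans (hC x))

theorem comp (hf : IsBddMeasurable f) {φ : β → α} (hφ : Measurable φ) :
    IsBddMeasurable (fun y => f (φ y)) := by
  obtain ⟨hf, C, hC⟩ := hf
  exact ⟨hf.comp hφ, C, fun y => hC _⟩

theorem integrable (hf : IsBddMeasurable f) (μ : Measure α) [IsFiniteMeasure μ] :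
    Integrable f μ := by
  obtain ⟨hf, C, hC⟩ := hf
  exact Integrable.of_bound hf.aestronglyMeasurable C (ae_of_all _ hC)

theorem integral_prod_right {F : α × β → ℝ} (hF : IsBddMeasurable F) (ν : Measure β)
    [IsProbabilityMeasure ν] : IsBddMeasurable (fun x => ∫ y, F (x, y) ∂ν) := by
  obtain ⟨hF, C, hC⟩ := hF
  refine ⟨(StronglyMeasurable.integral_prod_right (f := fun x y => F (x, y))
    hF.stronglyMeasurable).measurable, C, fun x => ?_⟩
  have := norm_integral_le_of_norm_le_const (μ := ν) (f := fun y => F (x, y)) (C := C)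
    (ae_of_all _ fun y => hC _)
  simpa using this

theorem integral_exp_pos (hf : IsBddMeasurable f) (μ : Measure α) [IsProbabilityMeasure μ] :
    0 < ∫ x, Real.exp (f x) ∂μ :=
  MeasureTheory.integral_exp_pos (hf.exp.integrable μ)

theorem log_integral_exp {F : α × β → ℝ} (hF : IsBddMeasurable F) (ν : Measure β)
    [IsProbabilityMeasure ν] :
    IsBddMeasurable (fun x => Real.log (∫ y, Real.exp (F (x, y)) ∂ν)) := by
  refine ⟨(hF.exp.integral_prod_right ν).1.log, ?_⟩
  have hF' := hF
  obtain ⟨hFm, C, hC⟩ := hF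
  refine ⟨C, fun x => ?_⟩
  have hx : IsBddMeasurable (fun y => F (x, y)) := hF'.comp measurable_prodMk_left
  have hpos := hx.integral_exp_pos ν
  rw [abs_le]
  constructor
  · rw [Real.le_log_iff_exp_le hpos]
    have := integral_mono ((const (Real.exp (-C))).integrable ν) (hx.exp.integrable ν)
      (fun y => Real.exp_le_exp.2 (abs_le.1 (hC (x, y))).1)
    simpa using this
  · rw [Real.log_le_iff_le_exp hpos]
    have := integral_mono (hx.exp.integrable ν) ((const (Real.exp C)).integrable ν)
      (fun y => Real.exp_le_exp.2 (abs_le.1 (hC (x, y))).2)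
    simpa using this

end IsBddMeasurable

/-! ### Entropy on product spaces -/

/-- Log-sum inequality. -/
theorem log_sum_le_integral {α : Type*} [MeasurableSpace α] (μ : Measure α)
    [IsProbabilityMeasure μ] {f g : α → ℝ} (hf : IsBddMeasurable f) (hg : IsBddMeasurable g) :
    (∫ x, Real.exp (f x) ∂μ) *
        (Real.log (∫ x, Real.exp (f x) ∂μ) - Real.log (∫ x, Real.exp (g x) ∂μ))
      ≤ ∫ x, Real.exp (f x) * (f x - g x) ∂μ := by
  set A := ∫ x, Real.exp (f x) ∂μ with hA
  set B := ∫ x, Real.exp (g x) ∂μ with hB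
  have hApos : 0 < A := hf.integral_exp_pos μ
  have hBpos : 0 < B := hg.integral_exp_pos μ
  set c := Real.log A - Real.log B with hc
  have hexpc : Real.exp c * B = A := by
    rw [hc, Real.exp_sub, Real.exp_log hApos, Real.exp_log hBpos]
    field_simp
  -- The tangent-line bound 1 + u ≤ e^u at u = c + g - f; the shift c equalises the two total
  -- masses, so the exponential terms cancel after integration.
  have hpt : ∀ x, Real.exp (f x) * (c + 1) - Real.exp c * Real.exp (g x)
      ≤ Real.exp (f x) * (f x - g x) := by
    intro x
    have h1 := Real.add_one_le_exp (c + g x - f x)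
    have h2 : Real.exp c * Real.exp (g x) = Real.exp (f x) * Real.exp (c + g x - f x) := by
      rw [← Real.exp_add, ← Real.exp_add]; ring_nf
    rw [h2]
    nlinarith [Real.exp_pos (f x)]
  have hI1 : Integrable (fun x => Real.exp (f x) * (c + 1)) μ := (hf.exp.integrable μ).mul_const _
  have hI2 : Integrable (fun x => Real.exp c * Real.exp (g x)) μ :=
    (hg.exp.integrable μ).const_mul _
  have := integral_mono (hI1.sub hI2) ((hf.exp.mul (hf.sub hg)).integrable μ) hpt
  rw [integral_sub' hI1 hI2, integral_mul_const, integral_const_mul, ← hA, ← hB, hexpc] at this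
  linarith

/-- The sub-additivity of entropy for a product of two probability measures, in a form in which
the first marginal entropy is bounded by its variational formula. -/
theorem integral_entropy_le_add {α β : Type*} [MeasurableSpace α] [MeasurableSpace β]
    (μ : Measure α) [IsProbabilityMeasure μ] (ν : Measure β) [IsProbabilityMeasure ν]
    {f : α × β → ℝ} (hf : IsBddMeasurable f) {g : β → ℝ} (hg : IsBddMeasurable g)
    {D : α × β → ℝ} (hD : IsBddMeasurable D)
    (hfib : ∀ x, ∫ y, Real.exp (f (x, y)) * f (x, y) ∂ν
      - (∫ y, Real.exp (f (x, y)) ∂ν) * Real.log (∫ y, Real.exp (f (x, y)) ∂ν)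
      ≤ ∫ y, D (x, y) ∂ν) :
    ∫ z, Real.exp (f z) * f z ∂(μ.prod ν)
      - (∫ z, Real.exp (f z) ∂(μ.prod ν)) * Real.log (∫ z, Real.exp (f z) ∂(μ.prod ν))
      ≤ (∫ z, (Real.exp (f z) * (f z - g z.2) - Real.exp (f z) + Real.exp (g z.2)) ∂(μ.prod ν))
        + ∫ z, D z ∂(μ.prod ν) := by
  have hg2 : IsBddMeasurable (fun z : α × β => g z.2) := hg.comp measurable_snd
  have hff := hf.exp.mul hf
  have hE := ((hf.exp.mul (hf.sub hg2)).sub hf.exp).add hg2.exp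
  have hApos := hf.integral_exp_pos (μ.prod ν)
  set A := ∫ z, Real.exp (f z) ∂(μ.prod ν) with hA
  set B := ∫ y, Real.exp (g y) ∂ν with hB
  have hBpos : 0 < B := hg.integral_exp_pos ν
  have hAx : A = ∫ x, ∫ y, Real.exp (f (x, y)) ∂ν ∂μ := integral_prod _ (hf.exp.integrable _)
  rw [integral_prod _ (hff.integrable _), integral_prod _ (hD.integrable _),
    integral_prod _ (hE.integrable _)]
  set Fb : α → ℝ := fun x => ∫ y, Real.exp (f (x, y)) ∂ν with hFb
  have hFbm : IsBddMeasurable Fb := hf.exp.integral_prod_right ν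
  have hFl : IsBddMeasurable (fun x => Fb x * Real.log (Fb x)) := hFbm.mul (hf.log_integral_exp ν)
  have h1 : ∫ x, ∫ y, Real.exp (f (x, y)) * f (x, y) ∂ν ∂μ - ∫ x, Fb x * Real.log (Fb x) ∂μ
      ≤ ∫ x, ∫ y, D (x, y) ∂ν ∂μ := by
    rw [← integral_sub ((hff.integral_prod_right ν).integrable μ) (hFl.integrable μ)]
    exact integral_mono (((hff.integral_prod_right ν).sub hFl).integrable μ)
      ((hD.integral_prod_right ν).integrable μ) hfib
  -- The entropy splits into the mean fibre entropy, bounded by `D`, and the entropy of the marginal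
  -- `Fb`. The log-sum inequality on each fibre handles the latter, because `g` does not see x.
  have h2 : ∀ x, Fb x * Real.log (Fb x) - Fb x * (Real.log B + 1) + B
      ≤ ∫ y, (Real.exp (f (x, y)) * (f (x, y) - g y) - Real.exp (f (x, y)) + Real.exp (g y)) ∂ν := by
    intro x
    have hx : IsBddMeasurable (fun y => f (x, y)) := hf.comp measurable_prodMk_left
    have hl := log_sum_le_integral ν hx hg
    rw [integral_add (((hx.exp.mul (hx.sub hg)).sub hx.exp).integrable ν) (hg.exp.integrable ν),
      integral_sub ((hx.exp.mul (hx.sub hg)).integrable ν) (hx.exp.integrable ν)]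
    simp only [hFb, hB]
    linarith
  have hi1 := hFl.integrable μ
  have hi2 : Integrable (fun x => Fb x * (Real.log B + 1)) μ := (hFbm.integrable μ).mul_const _
  have h3 := integral_mono ((hi1.sub hi2).add (integrable_const B))
    ((hE.integral_prod_right ν).integrable μ) h2
  rw [integral_add' (hi1.sub hi2) (integrable_const B), integral_sub' hi1 hi2, integral_mul_const,
    ← hAx] at h3
  simp only [integral_const, probReal_univ, one_smul] at h3
  have h4 : A * (Real.log B - Real.log A) ≤ B - A := by
    have := Real.log_le_sub_one_of_pos (div_pos hBpos hApos)
    rw [Real.log_div hBpos.ne' hApos.ne'] at this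
    calc A * (Real.log B - Real.log A) ≤ A * (B / A - 1) := by gcongr
      _ = B - A := by field_simp
  linarith

/-- Sub-additivity of entropy on a product space. -/
theorem entropy_pi_le_sum {E : Type*} [MeasurableSpace E] {n : ℕ} (ν : Fin n → Measure E)
    [∀ i, IsProbabilityMeasure (ν i)] {f : (Fin n → E) → ℝ} (hf : IsBddMeasurable f)
    {g : Fin n → (Fin n → E) → ℝ} (hg : ∀ i, IsBddMeasurable (g i))
    (hgu : ∀ i x a, g i (Function.update x i a) = g i x) :
    ∫ x, Real.exp (f x) * f x ∂(Measure.pi ν)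
      - (∫ x, Real.exp (f x) ∂(Measure.pi ν)) * Real.log (∫ x, Real.exp (f x) ∂(Measure.pi ν))
      ≤ ∑ i, ∫ x, (Real.exp (f x) * (f x - g i x) - Real.exp (f x) + Real.exp (g i x))
          ∂(Measure.pi ν) := by
  induction n with
  | zero =>
    have h : ∀ F : (Fin 0 → E) → ℝ, ∫ x, F x ∂(Measure.pi ν) = F default := by
      intro F
      rw [integral_congr_ae (g := fun _ => F default)
        (ae_of_all _ fun x => by rw [Subsingleton.elim x default])]
      simp
    rw [h, h]
    simp
  | succ n ih =>
    have mp := measurePreserving_piFinSuccAbove ν 0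
    set e := MeasurableEquiv.piFinSuccAbove (fun _ : Fin (n + 1) => E) 0
    have hint : ∀ F : (Fin (n + 1) → E) → ℝ, ∫ x, F x ∂(Measure.pi ν)
        = ∫ z, F (e.symm z) ∂((ν 0).prod (Measure.pi fun j => ν ((0 : Fin (n + 1)).succAbove j))) := by
      intro F
      rw [← mp.integral_comp e.measurableEmbedding]
      simp
    have hsymm : ∀ z, e.symm z = Fin.cons z.1 z.2 := fun z => by
      simp [e, MeasurableEquiv.piFinSuccAbove_symm_apply, Fin.insertNthEquiv]
    have hem : Measurable e.symm := e.symm.measurable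
    -- A base point of `E` is needed to read `g 0` as a function of the remaining coordinates.
    by_cases hE : Nonempty E
    swap
    · have : IsEmpty (Fin (n + 1) → E) := ⟨fun x => hE ⟨x 0⟩⟩
      have : Measure.pi ν = 0 := Measure.eq_zero_of_isEmpty _
      simp [this]
    obtain ⟨a⟩ := hE
    have h0 : ∀ z, g 0 (e.symm z) = g 0 (e.symm (a, z.2)) := by
      intro z
      rw [← hgu 0 (e.symm z) a]
      simp [hsymm]
    have hfe : IsBddMeasurable (fun z => f (e.symm z)) := hf.comp hem
    have hge : ∀ i, IsBddMeasurable (fun z => g i (e.symm z)) := fun i => (hg i).comp hem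
    have hDi : ∀ i : Fin n, IsBddMeasurable (fun z => Real.exp (f (e.symm z)) *
        (f (e.symm z) - g i.succ (e.symm z)) - Real.exp (f (e.symm z))
        + Real.exp (g i.succ (e.symm z))) := fun i =>
      ((hfe.exp.mul (hfe.sub (hge _))).sub hfe.exp).add (hge _).exp
    have hD : IsBddMeasurable (fun z => ∑ i : Fin n, (Real.exp (f (e.symm z)) *
        (f (e.symm z) - g i.succ (e.symm z)) - Real.exp (f (e.symm z))
        + Real.exp (g i.succ (e.symm z)))) := by
      refine ⟨Finset.measurable_sum _ fun i _ => (hDi i).1, ∑ i, (hDi i).2.choose, fun z => ?_⟩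
      exact (Finset.abs_sum_le_sum_abs _ _).trans
        (Finset.sum_le_sum fun i _ => (hDi i).2.choose_spec z)
    have key := integral_entropy_le_add (ν 0)
      (Measure.pi fun j => ν ((0 : Fin (n + 1)).succAbove j)) hfe
      (g := fun y => g 0 (e.symm (a, y))) ((hge 0).comp measurable_prodMk_left) hD ?_
    · rw [Fin.sum_univ_succ, hint, hint]
      simp only [hint]
      rw [integral_finsetSum _ fun i _ => (hDi i).integrable _] at key
      simp only [← h0] at key
      exact key
    · intro x
      rw [integral_finsetSum _ fun i _ => ((hDi i).comp measurable_prodMk_left).integrable _]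
      refine ih (fun j => ν ((0 : Fin (n + 1)).succAbove j))
        (f := fun y => f (e.symm (x, y))) (hfe.comp measurable_prodMk_left)
        (g := fun i y => g i.succ (e.symm (x, y)))
        (fun i => (hge _).comp measurable_prodMk_left) ?_
      intro i y b
      simp only [hsymm]
      rw [Fin.cons_update (α := fun _ => E), hgu]

/-! ### Entropy inequality for self-bounded functions -/

/-- Convexity bound for the function `u ↦ exp u - u - 1`. -/
theorem exp_neg_mul_sub_le {l d : ℝ} (h0 : 0 ≤ d) (h1 : d ≤ 1) :
    Real.exp (-(l * d)) + l * d - 1 ≤ d * (Real.exp (-l) + l - 1) := by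
  have := convexOn_exp.2 (Set.mem_univ (-l)) (Set.mem_univ 0) h0 (sub_nonneg.2 h1) (by ring)
  simp only [smul_eq_mul, mul_zero, add_zero, Real.exp_zero, mul_one] at this
  rw [show d * -l = -(l * d) by ring] at this
  linarith

/-- The entropy inequality for a self-bounded function of independent variables. -/
theorem one_sub_exp_neg_mul_integral_le {E : Type*} [MeasurableSpace E] {n : ℕ}
    (ν : Fin n → Measure E) [∀ i, IsProbabilityMeasure (ν i)] {f : (Fin n → E) → ℝ}
    (hf : IsBddMeasurable f) {g : Fin n → (Fin n → E) → ℝ} (hg : ∀ i, IsBddMeasurable (g i))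
    (hgu : ∀ i x a, g i (Function.update x i a) = g i x)
    (h0 : ∀ i x, 0 ≤ f x - g i x) (h1 : ∀ i x, f x - g i x ≤ 1)
    (hsum : ∀ x, ∑ i, (f x - g i x) ≤ f x) (l : ℝ) :
    (1 - Real.exp (-l)) * ∫ x, f x * Real.exp (l * f x) ∂(Measure.pi ν)
      ≤ mgf f (Measure.pi ν) l * cgf f (Measure.pi ν) l := by
  have hlf := hf.const_mul l
  have hi : ∀ i, IsBddMeasurable (fun x => Real.exp (l * f x) * (l * f x - l * g i x)
      - Real.exp (l * f x) + Real.exp (l * g i x)) := fun i =>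
    ((hlf.exp.mul (hlf.sub ((hg i).const_mul l))).sub hlf.exp).add ((hg i).const_mul l).exp
  have hent := entropy_pi_le_sum ν hlf (g := fun i x => l * g i x)
    (fun i => (hg i).const_mul l) (fun i x a => by rw [hgu])
  rw [← integral_finsetSum _ fun i _ => (hi i).integrable _] at hent
  have hφ : 0 ≤ Real.exp (-l) + l - 1 := by linarith [Real.add_one_le_exp (-l)]
  have hpt : ∀ x, ∑ i, (Real.exp (l * f x) * (l * f x - l * g i x)
      - Real.exp (l * f x) + Real.exp (l * g i x))
      ≤ (Real.exp (-l) + l - 1) * (f x * Real.exp (l * f x)) := by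
    intro x
    -- With d = f - g_i in [0, 1], each summand is e^{lf} (e^{-ld} + ld - 1); convexity makes it
    -- linear in d, so that the bound on the sum of the d applies.
    calc _ ≤ ∑ i, Real.exp (l * f x) * ((Real.exp (-l) + l - 1) * (f x - g i x)) := by
          refine Finset.sum_le_sum fun i _ => ?_
          have hb := exp_neg_mul_sub_le (l := l) (h0 i x) (h1 i x)
          have he : Real.exp (l * g i x)
              = Real.exp (l * f x) * Real.exp (-(l * (f x - g i x))) := by
            rw [← Real.exp_add]; ring_nf
          rw [he]
          nlinarith [Real.exp_pos (l * f x)]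
      _ = (Real.exp (-l) + l - 1) * Real.exp (l * f x) * ∑ i, (f x - g i x) := by
          rw [Finset.mul_sum]
          exact Finset.sum_congr rfl fun i _ => by ring
      _ ≤ (Real.exp (-l) + l - 1) * Real.exp (l * f x) * f x :=
          mul_le_mul_of_nonneg_left (hsum x) (mul_nonneg hφ (Real.exp_pos _).le)
      _ = _ := by ring
  have hfe : IsBddMeasurable (fun x => f x * Real.exp (l * f x)) := hf.mul hlf.exp
  have hle := integral_mono (integrable_finsetSum _ fun i _ => (hi i).integrable (Measure.pi ν))
    ((hfe.const_mul _).integrable _) hpt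
  rw [integral_const_mul] at hle
  have hl : ∫ x, Real.exp (l * f x) * (l * f x) ∂(Measure.pi ν)
      = l * ∫ x, f x * Real.exp (l * f x) ∂(Measure.pi ν) := by
    rw [← integral_const_mul]
    exact integral_congr_ae (ae_of_all _ fun x => by simp only; ring)
  rw [hl] at hent
  simp only [cgf, mgf]
  linarith

/-! ### From the entropy inequality to variance and tail bounds -/

section Concentration

variable {Ω : Type*} [MeasurableSpace Ω] {μ : Measure Ω} [IsProbabilityMeasure μ] {Z : Ω → ℝ}

theorem IsBddMeasurable.integrableExpSet_eq_univ (hZ : IsBddMeasurable Z) :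
    integrableExpSet Z μ = Set.univ :=
  Set.eq_univ_of_forall fun l => (hZ.const_mul l).exp.integrable μ

theorem IsBddMeasurable.mem_interior_integrableExpSet (hZ : IsBddMeasurable Z) (l : ℝ) :
    l ∈ interior (integrableExpSet Z μ) := by
  simp [hZ.integrableExpSet_eq_univ]

theorem IsBddMeasurable.differentiable_cgf (hZ : IsBddMeasurable Z) :
    Differentiable ℝ (cgf Z μ) := fun l =>
  (analyticAt_cgf (hZ.mem_interior_integrableExpSet l)).differentiableAt

/-- Integration of the entropy inequality (Herbst's argument). -/
theorem cgf_le_of_entropy_le (hZ : IsBddMeasurable Z)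
    (hent : ∀ l, (1 - Real.exp (-l)) * ∫ ω, Z ω * Real.exp (l * Z ω) ∂μ
      ≤ mgf Z μ l * cgf Z μ l) (l : ℝ) :
    cgf Z μ l ≤ (∫ ω, Z ω ∂μ) * (Real.exp l - 1) := by
  have hd := hZ.differentiable_cgf (μ := μ)
  have hdiff : ∀ s, (1 - Real.exp (-s)) * deriv (cgf Z μ) s ≤ cgf Z μ s := by
    intro s
    have hpos : 0 < mgf Z μ s := mgf_pos ((hZ.const_mul s).exp.integrable μ)
    rw [deriv_cgf (hZ.mem_interior_integrableExpSet s), mul_div_assoc', div_le_iff₀ hpos,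
      mul_comm (cgf Z μ s)]
    exact hent s
  set q : ℝ → ℝ := fun s => cgf Z μ s / (Real.exp s - 1) with hq
  have hne : ∀ s : ℝ, s ≠ 0 → Real.exp s - 1 ≠ 0 := fun s hs h => hs (by
    rw [← Real.exp_eq_one_iff]; linarith)
  have hqd : ∀ s, s ≠ 0 → HasDerivAt q
      ((deriv (cgf Z μ) s * (Real.exp s - 1) - cgf Z μ s * Real.exp s) / (Real.exp s - 1) ^ 2) s :=
    fun s hs => (hd s).hasDerivAt.div ((Real.hasDerivAt_exp s).sub_const 1) (hne s hs)
  have hqd' : ∀ s, s ≠ 0 → deriv q s ≤ 0 := by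
    intro s hs
    rw [(hqd s hs).deriv]
    refine div_nonpos_of_nonpos_of_nonneg ?_ (sq_nonneg _)
    have h1 : Real.exp s * Real.exp (-s) = 1 := by rw [← Real.exp_add]; simp
    have h2 := mul_le_mul_of_nonneg_left (hdiff s) (Real.exp_pos s).le
    linear_combination h2 + deriv (cgf Z μ) s * h1
  -- The half-lines are treated separately: at 0 the quotient takes the default value 0/0 = 0, not
  -- its limit.
  have hanti : ∀ D : Set ℝ, Convex ℝ D → IsOpen D → (∀ s ∈ D, s ≠ 0) → AntitoneOn q D := by
    intro D hD hDo hD0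
    refine antitoneOn_of_deriv_nonpos hD
      (fun s hs => (hqd s (hD0 s hs)).continuousAt.continuousWithinAt) ?_ ?_
    · rw [hDo.interior_eq]
      exact fun s hs => (hqd s (hD0 s hs)).differentiableAt.differentiableWithinAt
    · rw [hDo.interior_eq]
      exact fun s hs => hqd' s (hD0 s hs)
  have hlim : Filter.Tendsto q (nhdsWithin 0 {0}ᶜ) (nhds (∫ ω, Z ω ∂μ)) := by
    have h1 : HasDerivAt (cgf Z μ) (∫ ω, Z ω ∂μ) 0 := by
      have := (hd 0).hasDerivAt
      rw [deriv_cgf_zero (hZ.mem_interior_integrableExpSet 0)] at this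
      simpa using this
    have h2 : HasDerivAt Real.exp 1 0 := by simpa using Real.hasDerivAt_exp 0
    have h3 := (hasDerivAt_iff_tendsto_slope.1 h1).div (hasDerivAt_iff_tendsto_slope.1 h2)
      one_ne_zero
    rw [div_one] at h3
    refine h3.congr' ?_
    filter_upwards [self_mem_nhdsWithin] with s hs
    have hs' : s ≠ 0 := hs
    have := hne s hs'
    simp only [Pi.div_apply, slope_def_field, cgf_zero, Real.exp_zero, sub_zero, hq]
    field_simp
  rcases lt_trichotomy l 0 with hl | rfl | hl
  · have hv : ∫ ω, Z ω ∂μ ≤ q l := by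
      have hlim' := hlim.mono_left (nhdsWithin_mono 0 (fun s (hs : s < 0) => hs.ne) :
        nhdsWithin (0 : ℝ) (Set.Iio 0) ≤ _)
      refine le_of_tendsto hlim' ?_
      filter_upwards [Ioo_mem_nhdsLT hl] with s hs
      exact hanti (Set.Iio 0) (convex_Iio 0) isOpen_Iio (fun s hs => ne_of_lt hs) hl hs.2 hs.1.le
    have hneg : Real.exp l - 1 < 0 := by have := Real.exp_lt_exp.2 hl; rw [Real.exp_zero] at this; linarith
    rwa [hq, le_div_iff_of_neg hneg] at hv
  · simp
  · have hv : q l ≤ ∫ ω, Z ω ∂μ := by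
      have hlim' := hlim.mono_left (nhdsWithin_mono 0 (fun s (hs : 0 < s) => hs.ne') :
        nhdsWithin (0 : ℝ) (Set.Ioi 0) ≤ _)
      refine ge_of_tendsto hlim' ?_
      filter_upwards [Ioo_mem_nhdsGT hl] with s hs
      exact hanti (Set.Ioi 0) (convex_Ioi 0) isOpen_Ioi (fun s hs => ne_of_gt hs) hs.1 hl hs.2.le
    have hpos : 0 < Real.exp l - 1 := by linarith [Real.one_lt_exp_iff.2 hl]
    rwa [hq, div_le_iff₀ hpos] at hv

theorem integral_exp_mul_sub_eq (hZ : IsBddMeasurable Z) (l m : ℝ) :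
    ∫ ω, Real.exp (l * (Z ω - m)) ∂μ = Real.exp (cgf Z μ l - l * m) := by
  rw [Real.exp_sub, exp_cgf ((hZ.const_mul l).exp.integrable μ), mgf, ← integral_div]
  exact integral_congr_ae (ae_of_all _ fun ω => by simp only [mul_sub, Real.exp_sub])

/-- The difference F of the two sides of the hypothesis is ≤ 0, with F(0) = F'(0) = 0 and F''(0) =
Var Z - E Z. Were F''(0) positive, 0 would be a local minimum, so F would vanish near 0, a
contradiction. -/
theorem variance_le_of_cgf_le (hZ : IsBddMeasurable Z)
    (hcgf : ∀ l, cgf Z μ l ≤ (∫ ω, Z ω ∂μ) * (Real.exp l - 1)) :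
    variance Z μ ≤ ∫ ω, Z ω ∂μ := by
  set v := ∫ ω, Z ω ∂μ with hv
  set F : ℝ → ℝ := fun l => cgf Z μ l - v * (Real.exp l - 1) with hF
  have hF1 : ∀ l, HasDerivAt F (deriv (cgf Z μ) l - v * Real.exp l) l := fun l =>
    (hZ.differentiable_cgf l).hasDerivAt.sub
      (((Real.hasDerivAt_exp l).sub_const 1).const_mul v)
  have hF0 : F 0 = 0 := by simp [hF]
  have hdF : deriv F = fun l => deriv (cgf Z μ) l - v * Real.exp l :=
    funext fun l => (hF1 l).deriv
  have hd2 : HasDerivAt (deriv (cgf Z μ)) (variance Z μ) 0 := by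
    have h1 : DifferentiableAt ℝ (deriv (cgf Z μ)) 0 :=
      (analyticAt_cgf (hZ.mem_interior_integrableExpSet 0)).deriv.differentiableAt
    have h2 := variance_tilted_mul (hZ.mem_interior_integrableExpSet (μ := μ) 0)
    rw [iteratedDeriv_succ, iteratedDeriv_one] at h2
    have h3 : (μ.tilted fun x => 0 * Z x) = μ := by simp
    rw [h3] at h2
    rw [h2]
    exact h1.hasDerivAt
  have hddF : deriv (deriv F) 0 = variance Z μ - v := by
    rw [hdF]
    have := (hd2.fun_sub ((Real.hasDerivAt_exp 0).const_mul v)).deriv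
    simpa using this
  have hdF0 : deriv F 0 = 0 := by
    rw [hdF]
    simp [deriv_cgf_zero (hZ.mem_interior_integrableExpSet (μ := μ) 0), hv]
  by_contra! hlt
  have hmin := isLocalMin_of_deriv_deriv_pos (f := F) (x₀ := 0) (by rw [hddF]; linarith) hdF0
    (hF1 0).continuousAt
  have hzero : F =ᶠ[nhds 0] fun _ => (0 : ℝ) := by
    filter_upwards [hmin] with l hl
    refine le_antisymm ?_ (hF0 ▸ hl)
    have := hcgf l
    simp only [hF]
    linarith
  have h := hzero.deriv.deriv_eq
  rw [hddF] at h
  simp at h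
  linarith

/-- Differentiating twice reduces the claim to 1 - s ≤ e^{-s}. This passes from the Poisson-type
exponent to the Bernstein one. -/
theorem exp_sub_sub_one_mul_le {l : ℝ} (hl : 0 ≤ l) :
    2 * (1 - l / 3) * (Real.exp l - l - 1) ≤ l ^ 2 := by
  have hmono : ∀ (f f' : ℝ → ℝ), (∀ s, HasDerivAt f (f' s) s) → (∀ s, 0 ≤ s → 0 ≤ f' s) →
      f 0 = 0 → ∀ s, 0 ≤ s → 0 ≤ f s := by
    intro f f' hf hf' h0 s hs
    have : MonotoneOn f (Set.Ici 0) := by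
      refine monotoneOn_of_deriv_nonneg (convex_Ici 0)
        (fun s _ => (hf s).continuousAt.continuousWithinAt)
        (fun s _ => (hf s).differentiableAt.differentiableWithinAt) fun s hs => ?_
      rw [(hf s).deriv]
      exact hf' s (interior_subset hs)
    simpa [h0] using this (Set.self_mem_Ici (a := (0 : ℝ))) hs hs
  have h1 := hmono (fun s => 2 / 3 * s + 4 / 3 + Real.exp s * (2 / 3 * s - 4 / 3))
    (fun s => 2 / 3 + Real.exp s * (2 / 3 * s - 2 / 3))
    (fun s => by
      refine ((((hasDerivAt_id' s).const_mul (2 / 3 : ℝ)).add_const (4 / 3)).fun_add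
        ((Real.hasDerivAt_exp s).fun_mul
          (((hasDerivAt_id' s).const_mul (2 / 3 : ℝ)).sub_const (4 / 3)))).congr_deriv ?_
      ring)
    (fun s _ => by
      have h1 : Real.exp s * Real.exp (-s) = 1 := by rw [← Real.exp_add]; simp
      have h2 := mul_le_mul_of_nonneg_left (Real.add_one_le_exp (-s)) (Real.exp_pos s).le
      linarith) (by simp)
  have h2 := hmono (fun s => s ^ 2 - 2 * (1 - s / 3) * (Real.exp s - s - 1))
    (fun s => 2 / 3 * s + 4 / 3 + Real.exp s * (2 / 3 * s - 4 / 3))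
    (fun s => by
      have ha := ((hasDerivAt_id' s).div_const 3).const_sub 1 |>.const_mul (2 : ℝ)
      have hb := ((Real.hasDerivAt_exp s).fun_sub (hasDerivAt_id' s)).sub_const 1
      refine ((hasDerivAt_pow 2 s).fun_sub (ha.fun_mul hb)).congr_deriv ?_
      push_cast; ring) h1 (by simp) l hl
  linarith

theorem exp_neg_add_sub_one_le {l : ℝ} (hl : 0 ≤ l) :
    Real.exp (-l) + l - 1 ≤ l ^ 2 / 2 := by
  have h := Real.quadratic_le_exp_of_nonneg hl
  have h1 : Real.exp l * Real.exp (-l) = 1 := by rw [← Real.exp_add]; simp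
  have h2 : (1 + l + l ^ 2 / 2) * Real.exp (-l) ≤ 1 := by
    exact (mul_le_mul_of_nonneg_right h (Real.exp_pos _).le).trans h1.le
  have h3 : Real.exp (-l) ≤ 1 / (1 + l + l ^ 2 / 2) := by
    rw [le_div_iff₀ (by positivity)]; linarith
  -- The product of the two quadratics is 1 + l^4/4.
  have h4 : 1 / (1 + l + l ^ 2 / 2) ≤ 1 - l + l ^ 2 / 2 := by
    rw [div_le_iff₀ (by positivity)]; nlinarith [sq_nonneg (l ^ 2)]
  linarith

theorem measureReal_upper_tail_le (hZ : IsBddMeasurable Z)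
    (hcgf : ∀ l, cgf Z μ l ≤ (∫ ω, Z ω ∂μ) * (Real.exp l - 1)) (hpos : 0 < ∫ ω, Z ω ∂μ)
    {t : ℝ} (ht : 0 < t) :
    μ.real {ω | t ≤ Z ω - ∫ ω', Z ω' ∂μ}
      ≤ Real.exp (-(t ^ 2 / (2 * ((∫ ω, Z ω ∂μ) + t / 3)))) := by
  set v := ∫ ω, Z ω ∂μ with hv
  -- This maximises the quadratic surrogate lt - l²(v + t/3)/2 of the Chernoff exponent.
  set l := t / (v + t / 3) with hl
  have hden : 0 < v + t / 3 := by positivity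
  have hl0 : 0 < l := div_pos ht hden
  have hset : {ω | t ≤ Z ω - v} = {ω | t + v ≤ Z ω} := by
    ext ω; simp only [Set.mem_ofPred_eq]; constructor <;> intro h <;> linarith
  rw [hset]
  refine (measure_ge_le_exp_cgf _ hl0.le ((hZ.const_mul l).exp.integrable μ)).trans ?_
  refine Real.exp_le_exp.2 ?_
  have h1 := exp_sub_sub_one_mul_le hl0.le
  have h2 : 1 - l / 3 = v / (v + t / 3) := by rw [hl]; field_simp; ring
  have h3 : v * (Real.exp l - l - 1) ≤ l ^ 2 * (v + t / 3) / 2 := by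
    rw [h2] at h1
    have := mul_le_mul_of_nonneg_right h1 hden.le
    have h4 : 2 * (v / (v + t / 3)) * (Real.exp l - l - 1) * (v + t / 3)
      = 2 * (v * (Real.exp l - l - 1)) := by field_simp
    linarith
  have h5 : l * t - l ^ 2 * (v + t / 3) / 2 = t ^ 2 / (2 * (v + t / 3)) := by
    rw [hl]; field_simp; ring
  have := hcgf l
  linarith

theorem measureReal_lower_tail_le (hZ : IsBddMeasurable Z)
    (hcgf : ∀ l, cgf Z μ l ≤ (∫ ω, Z ω ∂μ) * (Real.exp l - 1)) (hpos : 0 < ∫ ω, Z ω ∂μ)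
    {t : ℝ} (ht : 0 < t) :
    μ.real {ω | Z ω - ∫ ω', Z ω' ∂μ ≤ -t} ≤ Real.exp (-(t ^ 2 / (2 * ∫ ω, Z ω ∂μ))) := by
  set v := ∫ ω, Z ω ∂μ with hv
  -- This maximises lt - vl²/2.
  set l := t / v with hl
  have hl0 : 0 < l := div_pos ht hpos
  have hset : {ω | Z ω - v ≤ -t} = {ω | Z ω ≤ v - t} := by
    ext ω; simp only [Set.mem_ofPred_eq]; constructor <;> intro h <;> linarith
  rw [hset]
  refine (measure_le_le_exp_cgf (t := -l) _ (by linarith)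
    ((hZ.const_mul (-l)).exp.integrable μ)).trans ?_
  refine Real.exp_le_exp.2 ?_
  have h1 := mul_le_mul_of_nonneg_left (exp_neg_add_sub_one_le hl0.le) hpos.le
  have h5 : l * t - v * (l ^ 2 / 2) = t ^ 2 / (2 * v) := by rw [hl]; field_simp; ring
  have := hcgf (-l)
  linarith

end Concentration

/-! ### Exceedance counts and the empirical threshold -/

/-- The number of sample points that exceed `k`. -/
noncomputable def exceedCount {n : ℕ} (x : Fin n → ℝ) (k : ℕ) : ℕ :=
  (Finset.univ.filter fun i => (k : ℝ) < x i).card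

theorem exceedCount_anti {n : ℕ} (x : Fin n → ℝ) {k l : ℕ} (hkl : k ≤ l) :
    exceedCount x l ≤ exceedCount x k := by
  refine Finset.card_le_card fun i hi => ?_
  have hkl' : (k : ℝ) ≤ l := by exact_mod_cast hkl
  simp only [Finset.mem_filter, Finset.mem_univ, true_and] at hi ⊢
  exact hkl'.trans_lt hi

theorem orderStat_le_iff {n : ℕ} (x : Fin n → ℝ) (j : Fin n) (k : ℕ) :
    orderStat x j ≤ k ↔ exceedCount x k ≤ j := by
  have hanti : Antitone (orderStat x) := fun a b hab =>
    Tuple.monotone_sort x (Fin.rev_le_rev.2 hab)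
  have hcard : (Finset.univ.filter fun i => (k : ℝ) < orderStat x i).card = exceedCount x k :=
    Finset.card_equiv (Fin.revPerm.trans (Tuple.sort x)) (fun i => by
      simp only [Finset.mem_filter, Finset.mem_univ, true_and]; rfl)
  rw [← not_lt, ← Tuple.lt_card_gt_iff_apply_gt_of_antitone hanti, hcard, not_lt]

theorem empThreshold_le_self {n : ℕ} (x : Fin n → ℝ) : empThreshold x ≤ n :=
  Nat.sInf_le (Set.mem_insert _ _)

/-- Rank k satisfies the defining condition iff at most k - 1 points exceed k. Counts decrease in k,
so the condition persists once it holds. The bound k < n excludes the adjoined element n. -/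
theorem empThreshold_le_iff {n : ℕ} (x : Fin n → ℝ) {k : ℕ} (hk : 1 ≤ k) (hkn : k < n) :
    empThreshold x ≤ k ↔ exceedCount x k < k := by
  constructor
  · intro h
    have hmem : empThreshold x ∈ insert n {k : ℕ | ∃ j : Fin n, k = (j : ℕ) + 1 ∧
      orderStat x j ≤ (k : ℝ)} := Nat.sInf_mem (Set.insert_nonempty _ _)
    rcases hmem with hmem | ⟨j, hj, hle⟩
    · omega
    · rw [orderStat_le_iff] at hle
      have := exceedCount_anti x h
      omega
  · intro h
    refine Nat.sInf_le (Set.mem_insert_of_mem _ ⟨⟨k - 1, by omega⟩, ?_, ?_⟩)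
    · simp only; omega
    · rw [orderStat_le_iff]
      simp only; omega

theorem one_le_empThreshold {n : ℕ} (hn : 1 ≤ n) (x : Fin n → ℝ) : 1 ≤ empThreshold x := by
  have hmem : empThreshold x ∈ insert n {k : ℕ | ∃ j : Fin n, k = (j : ℕ) + 1 ∧
    orderStat x j ≤ (k : ℝ)} := Nat.sInf_mem (Set.insert_nonempty _ _)
  rcases hmem with hmem | ⟨j, hj, -⟩ <;> omega

theorem measurable_exceedCount {n : ℕ} (k : ℕ) :
    Measurable fun x : Fin n → ℝ => exceedCount x k := by
  have h : (fun x : Fin n → ℝ => exceedCount x k)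
      = fun x => ∑ i, {y : Fin n → ℝ | (k : ℝ) < y i}.indicator (fun _ => 1) x := by
    funext x
    simp only [exceedCount, Finset.card_filter, Set.indicator_apply, Set.mem_ofPred_eq]
  rw [h]
  exact Finset.measurable_sum _ fun i _ => measurable_const.indicator
    (measurableSet_lt measurable_const (measurable_pi_apply i))

theorem measurable_empThreshold {n : ℕ} (hn : 1 ≤ n) :
    Measurable fun x : Fin n → ℝ => empThreshold x := by
  refine measurable_of_Iic fun k => ?_
  rcases Nat.eq_zero_or_pos k with rfl | hk
  · convert MeasurableSet.empty
    ext x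
    have := one_le_empThreshold hn x
    simp only [Set.mem_preimage, Set.mem_Iic, Set.mem_empty_iff_false, iff_false]
    omega
  · rcases lt_or_ge k n with hkn | hkn
    · have : (fun x : Fin n → ℝ => empThreshold x) ⁻¹' Set.Iic k
          = (fun x => exceedCount x k) ⁻¹' Set.Iio k := by
        ext x
        exact empThreshold_le_iff x hk hkn
      rw [this]
      exact measurable_exceedCount k measurableSet_Iio
    · convert MeasurableSet.univ
      ext x
      have := empThreshold_le_self x
      simp only [Set.mem_preimage, Set.mem_Iic, Set.mem_univ, iff_true]
      omega

/-! ### Effect of removing one sample point -/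

section Update

variable {n : ℕ} (x : Fin n → ℝ) (i : Fin n)

/-- The value 0 exceeds no natural number, so it acts as a deletion that keeps the sample size. -/
theorem exceedCount_update_zero (k : ℕ) :
    exceedCount x k = exceedCount (Function.update x i 0) k + if (k : ℝ) < x i then 1 else 0 := by
  simp only [exceedCount, Finset.card_filter]
  rw [← Finset.add_sum_erase _ _ (Finset.mem_univ i),
    ← Finset.add_sum_erase (a := i) _ (fun j => if (k : ℝ) < Function.update x i 0 j then 1 else 0)
      (Finset.mem_univ i)]
  have : ∑ j ∈ Finset.univ.erase i, (if (k : ℝ) < Function.update x i 0 j then 1 else 0)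
      = ∑ j ∈ Finset.univ.erase i, (if (k : ℝ) < x j then 1 else 0) :=
    Finset.sum_congr rfl fun j hj => by
      rw [Function.update_of_ne (Finset.ne_of_mem_erase hj)]
  rw [this]
  have h0 : ¬ ((k : ℝ) < 0) := not_lt.2 (Nat.cast_nonneg k)
  simp [h0, add_comm]

theorem empThreshold_update_zero_le (hn : 1 ≤ n) :
    empThreshold (Function.update x i 0) ≤ empThreshold x := by
  rcases (empThreshold_le_self x).eq_or_lt with h | h
  · rw [h]; exact empThreshold_le_self _
  · have h1 := one_le_empThreshold hn x
    rw [empThreshold_le_iff _ h1 h]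
    have := (empThreshold_le_iff x h1 h).1 le_rfl
    have := exceedCount_update_zero x i (empThreshold x)
    omega

theorem empThreshold_le_update_zero_add_one (hn : 1 ≤ n) :
    empThreshold x ≤ empThreshold (Function.update x i 0) + 1 := by
  set m := empThreshold (Function.update x i 0) with hm
  rcases lt_or_ge (m + 1) n with h | h
  · have h1 : 1 ≤ m := one_le_empThreshold hn _
    rw [empThreshold_le_iff x (by omega) h]
    have h2 := (empThreshold_le_iff (Function.update x i 0) h1 (by omega)).1 le_rfl
    have h3 := exceedCount_update_zero x i m
    have h4 := exceedCount_anti x (Nat.le_succ m)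
    simp only [Nat.succ_eq_add_one] at h4
    -- Restoring one point gives N(m + 1) ≤ N(m) ≤ (m - 1) + 1 < m + 1.
    split_ifs at h3 <;> omega
  · exact (empThreshold_le_self x).trans h

theorem sum_empThreshold_sub_update_le (hn : 1 ≤ n) :
    ∑ i, ((empThreshold x : ℝ) - empThreshold (Function.update x i 0)) ≤ empThreshold x := by
  set m := empThreshold x with hm
  have hm1 : 1 ≤ m := one_le_empThreshold hn x
  have hmn : m ≤ n := empThreshold_le_self x
  by_cases hall : ∀ i, empThreshold (Function.update x i 0) = m
  · simp [hall]
  push Not at hall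
  obtain ⟨i₀, hi₀⟩ := hall
  -- If deleting point i lowers the threshold, the count at m - 1 falls below m - 1 only after the
  -- deletion; hence point i was counted there, and the full count was at most m - 1.
  have hlt : ∀ i, empThreshold (Function.update x i 0) ≠ m → 2 ≤ m ∧ ((m - 1 : ℕ) : ℝ) < x i ∧
      exceedCount x (m - 1) ≤ m - 1 := by
    intro i hi
    have h1 := one_le_empThreshold hn (Function.update x i 0)
    have h2 := empThreshold_update_zero_le x i hn
    have h3 : empThreshold (Function.update x i 0) ≤ m - 1 := by omega
    have h4 := (empThreshold_le_iff _ (by omega) (by omega)).1 h3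
    have h5 : ¬ exceedCount x (m - 1) < m - 1 := by
      rw [← empThreshold_le_iff x (by omega) (by omega)]
      omega
    have h6 := exceedCount_update_zero x i (m - 1)
    refine ⟨by omega, ?_⟩
    split_ifs at h6 with h7
    · exact ⟨h7, by omega⟩
    · omega
  have hcount := (hlt i₀ hi₀).2.2
  calc ∑ i, ((m : ℝ) - empThreshold (Function.update x i 0))
      ≤ ∑ i, (if ((m - 1 : ℕ) : ℝ) < x i then (1 : ℝ) else 0) := by
        refine Finset.sum_le_sum fun i _ => ?_
        by_cases hi : empThreshold (Function.update x i 0) = m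
        · rw [hi, sub_self]
          split_ifs <;> norm_num
        · rw [if_pos (hlt i hi).2.1]
          have : (m : ℝ) ≤ empThreshold (Function.update x i 0) + 1 := by
            exact_mod_cast empThreshold_le_update_zero_add_one x i hn
          linarith
    _ = exceedCount x (m - 1) := by simp [exceedCount, Finset.sum_boole]
    _ ≤ m := by exact_mod_cast hcount.trans (Nat.sub_le _ _)

end Update

/-! ### Self-boundedness and concentration of the threshold -/

theorem isBddMeasurable_empThreshold {n : ℕ} (hn : 1 ≤ n) :
    IsBddMeasurable fun x : Fin n → ℝ => (empThreshold x : ℝ) := by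
  refine ⟨(measurable_of_countable (fun k : ℕ => (k : ℝ))).comp (measurable_empThreshold hn),
    n, fun x => ?_⟩
  rw [abs_of_nonneg (Nat.cast_nonneg _)]
  exact Nat.cast_le.2 (empThreshold_le_self x)

theorem isSelfBounded_empThreshold {Ω : Type*} {n : ℕ} (hn : 1 ≤ n) (X : Fin n → Ω → ℝ) :
    IsSelfBounded X fun ω => (empThreshold (fun i => X i ω) : ℝ) where
  nonneg _ := Nat.cast_nonneg _
  exists_eq := ⟨_, (isBddMeasurable_empThreshold hn).1, fun _ => rfl⟩
  exists_bound := by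
    refine ⟨fun i y => empThreshold fun j => if hj : j ≠ i then y ⟨j, hj⟩ else 0, fun i => ?_, ?_⟩
    · refine (isBddMeasurable_empThreshold hn).1.comp (measurable_pi_lambda _ fun j => ?_)
      by_cases hj : j ≠ i
      · simpa only [dif_pos hj] using measurable_pi_apply _
      · simpa only [dif_neg hj] using measurable_const
    · have hupd : ∀ ω i, (fun j => if hj : j ≠ i then X j ω else 0)
          = Function.update (fun j => X j ω) i 0 := by
        intro ω i
        funext j
        by_cases hj : j = i <;> simp [hj]
      simp only [hupd]
      refine ⟨fun ω i => ⟨?_, ?_⟩, fun ω => sum_empThreshold_sub_update_le _ hn⟩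
      · rw [sub_nonneg]
        exact_mod_cast empThreshold_update_zero_le _ i hn
      · rw [sub_le_iff_le_add, add_comm 1]
        exact_mod_cast empThreshold_le_update_zero_add_one (fun j => X j ω) i hn

theorem cgf_empThreshold_le {Ω : Type*} [MeasurableSpace Ω] (μ : Measure Ω)
    [IsProbabilityMeasure μ] {n : ℕ} (hn : 1 ≤ n) {X : Fin n → Ω → ℝ}
    (hmeas : ∀ i, Measurable (X i)) (hindep : iIndepFun X μ) (l : ℝ) :
    cgf (fun ω => (empThreshold (fun i => X i ω) : ℝ)) μ l
      ≤ (∫ ω, (empThreshold (fun i => X i ω) : ℝ) ∂μ) * (Real.exp l - 1) := by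
  have hXm : Measurable fun ω i => X i ω := measurable_pi_lambda _ hmeas
  have hT := isBddMeasurable_empThreshold hn
  have hprob : ∀ i, IsProbabilityMeasure (μ.map (X i)) := fun i =>
    Measure.isProbabilityMeasure_map (hmeas i).aemeasurable
  -- Independence makes the joint law a product, where the entropy inequality applies.
  have hlaw := (iIndepFun_iff_map_fun_eq_pi_map fun i => (hmeas i).aemeasurable).1 hindep
  refine cgf_le_of_entropy_le (hT.comp hXm) (fun s => ?_) l
  have hent := one_sub_exp_neg_mul_integral_le (fun i => μ.map (X i)) hT
    (g := fun i x => empThreshold (Function.update x i 0))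
    (fun i => hT.comp (measurable_update' (a := i) |>.comp (measurable_id.prodMk measurable_const)))
    (fun i x a => by rw [Function.update_idem])
    (fun i x => by
      rw [sub_nonneg]
      exact_mod_cast empThreshold_update_zero_le x i hn)
    (fun i x => by
      rw [sub_le_iff_le_add, add_comm 1]
      exact_mod_cast empThreshold_le_update_zero_add_one x i hn)
    (fun x => sum_empThreshold_sub_update_le x hn) s
  have hTe := hT.mul (hT.const_mul s).exp
  rw [← hlaw, integral_map hXm.aemeasurable hTe.1.aestronglyMeasurable, cgf,
    mgf_map hXm.aemeasurable (hT.const_mul s).exp.1.aestronglyMeasurable] at hent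
  exact hent

theorem lemmaC1 {Ω : Type*} [MeasurableSpace Ω] (μ : Measure Ω) [IsProbabilityMeasure μ]
    (n : ℕ) (hn : 1 ≤ n) (X : Fin n → Ω → ℝ) (hmeas : ∀ i, Measurable (X i))
    (hindep : iIndepFun X μ) (hident : ∀ i j, IdentDistrib (X i) (X j) μ μ)
    (M : Ω → ℝ) (hM : ∀ ω, M ω = (empThreshold (fun i => X i ω) : ℝ)) :
    IsSelfBounded X M ∧
    (MemLp M 2 μ ∧ variance M μ ≤ ∫ ω, M ω ∂μ) ∧
    (∀ l : ℝ,
      Integrable (fun ω => Real.exp (l * (M ω - ∫ ω', M ω' ∂μ))) μ ∧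
      Real.log (∫ ω, Real.exp (l * (M ω - ∫ ω', M ω' ∂μ)) ∂μ)
        ≤ (∫ ω, M ω ∂μ) * (Real.exp l - l - 1)) ∧
    (∀ t : ℝ, 0 < t →
      μ.real {ω | t ≤ M ω - ∫ ω', M ω' ∂μ}
        ≤ Real.exp (-(t ^ 2 / (2 * ((∫ ω, M ω ∂μ) + t / 3)))) ∧
      μ.real {ω | M ω - ∫ ω', M ω' ∂μ ≤ -t}
        ≤ Real.exp (-(t ^ 2 / (2 * ∫ ω, M ω ∂μ)))) := by
  obtain rfl : M = fun ω => (empThreshold (fun i => X i ω) : ℝ) := funext hM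
  have hMb : IsBddMeasurable fun ω => (empThreshold (fun i => X i ω) : ℝ) :=
    (isBddMeasurable_empThreshold hn).comp (measurable_pi_lambda _ hmeas)
  have hcgf := cgf_empThreshold_le μ hn hmeas hindep
  -- The mean is at least 1; positivity permits the division by it in the lower-tail parameter.
  have hpos : 0 < ∫ ω, (empThreshold (fun i => X i ω) : ℝ) ∂μ := by
    have := integral_mono (integrable_const (1 : ℝ)) (hMb.integrable μ)
      (fun ω => Nat.one_le_cast.2 (one_le_empThreshold hn fun i => X i ω))
    simp only [integral_const, probReal_univ, one_smul] at this
    exact one_pos.trans_le this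
  refine ⟨isSelfBounded_empThreshold hn X, ⟨?_, variance_le_of_cgf_le hMb hcgf⟩,
    fun l => ⟨?_, ?_⟩, fun t ht =>
      ⟨measureReal_upper_tail_le hMb hcgf hpos ht, measureReal_lower_tail_le hMb hcgf hpos ht⟩⟩
  · obtain ⟨hm, C, hC⟩ := hMb
    exact MemLp.of_bound hm.aestronglyMeasurable C (ae_of_all _ hC)
  · exact ((hMb.sub (IsBddMeasurable.const _)).const_mul l).exp.integrable μ
  · rw [integral_exp_mul_sub_eq hMb, Real.log_exp]
    linarith [hcgf l]
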